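/- Let $k\ge 1$, let $C\subseteq\mathbb R^k$ be convex, let $R,\Sigma$ be symmetric positive semidefinite real $k\times k$ matrices, and let $\alpha>0$. Let $f:\mathbb R^k\to\mathbb R$ satisfy $|f(\theta)-f(\theta')|\le L\|\theta-\theta'\|$ for all $\theta,\theta'\in\mathbb R^k$ (Euclidean norm), and put $g(\theta)=f(\theta)+\tfrac12\theta^{T}R\theta$. With $\omega\sim\mathcal N(0,\Sigma)$, write $\overline h_\Sigma(\theta)=\mathbb E[h(\theta+\omega)]$ for $h=f,g$, and define the sensitivity function $$S_{\alpha,\Sigma}(\theta)=\frac1\alpha\log\mathbb E\big[\exp\big(\alpha\,(f(\theta+\omega)-\overline f_\Sigma(\theta))\big)\big].$$ Then $\mathbb E[f(\theta+\omega)]$, $\mathbb E[g(\theta+\omega)]$ and $\mathbb E[e^{\alpha f(\theta+\omega)}]$ exist and are finite for every $\theta\in\mathbb R^k$, and $$S_{\alpha,\Sigma}(\theta)\le\tfrac12\,\alpha L^2\lambda_{\max}(\Sigma)\qquad\text{for every }\theta\in\mathbb R^k,$$ where $\lambda_{\max}(\Sigma)$ is the largest eigenvalue of $\Sigma$. Further,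 if $\theta_\alpha^*\in C$ minimizes the convexified objective $$\theta\mapsto\frac1\alpha\log\mathbb E\big[e^{\alpha f(\theta+\omega)}\big]+\tfrac12\theta^{T}R\theta$$ over $C$, then $\overline g_\Sigma$ is bounded below on $C$ and $$\overline g_\Sigma(\theta_\alpha^*)-\inf_{\theta\in C}\overline g_\Sigma(\theta)\le\frac{\alpha L^2\lambda_{\max}(\Sigma)}2 .$$ -/

import Mathlib

open MeasureTheory ProbabilityTheory Matrix

noncomputable section

namespace GaussianConvexification

variable {k : ℕ}

/-- The quadratic form `xᵀ A x`. -/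
def quadForm (A : Matrix (Fin k) (Fin k) ℝ) (x : EuclideanSpace ℝ (Fin k)) : ℝ :=
  x.ofLp ⬝ᵥ (A *ᵥ x.ofLp)

/-- The maximum eigenvalue of a real symmetric matrix. -/
def lambdaMax {A : Matrix (Fin k) (Fin k) ℝ} (hA : A.IsHermitian) : ℝ :=
  ⨆ i : Fin k, hA.eigenvalues i

/-- The objective `g(θ) = f(θ) + ½ θᵀ R θ`. -/
def objective (f : EuclideanSpace ℝ (Fin k) → ℝ) (R : Matrix (Fin k) (Fin k) ℝ)
    (θ : EuclideanSpace ℝ (Fin k)) : ℝ :=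
  f θ + 1 / 2 * quadForm R θ

/-- The Gaussian smoothing `E[h(θ + ω)]`, `ω ∼ N(0, S)`. -/
def smooth (h : EuclideanSpace ℝ (Fin k) → ℝ) (S : Matrix (Fin k) (Fin k) ℝ)
    (θ : EuclideanSpace ℝ (Fin k)) : ℝ :=
  ∫ ω, h (θ + ω) ∂(multivariateGaussian 0 S)

/-- The risk-averse smoothing `(1/α) log E[exp(α f(θ + ω))]`, `ω ∼ N(0, S)`. -/
def softSmooth (f : EuclideanSpace ℝ (Fin k) → ℝ) (α : ℝ) (S : Matrix (Fin k) (Fin k) ℝ)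
    (θ : EuclideanSpace ℝ (Fin k)) : ℝ :=
  1 / α * Real.log (∫ ω, Real.exp (α * f (θ + ω)) ∂(multivariateGaussian 0 S))

/-- The convexified objective `(1/α) log E[exp(α f(θ + ω))] + ½ θᵀ R θ`. -/
def convexified (f : EuclideanSpace ℝ (Fin k) → ℝ) (α : ℝ) (S R : Matrix (Fin k) (Fin k) ℝ)
    (θ : EuclideanSpace ℝ (Fin k)) : ℝ :=
  softSmooth f α S θ + 1 / 2 * quadForm R θ

/-- The sensitivity function `(1/α) log E[exp(α (f(θ + ω) - E[f(θ + ω)]))]`, `ω ∼ N(0, S)`. -/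
def sensitivity (f : EuclideanSpace ℝ (Fin k) → ℝ) (α : ℝ) (S : Matrix (Fin k) (Fin k) ℝ)
    (θ : EuclideanSpace ℝ (Fin k)) : ℝ :=
  1 / α * Real.log
    (∫ ω, Real.exp (α * (f (θ + ω) - smooth f S θ)) ∂(multivariateGaussian 0 S))

end GaussianConvexification

end

/-! With ω ∼ N(0, Σ), the core is the sharp exponential moment bound E exp f(ω) ≤ exp(E f(ω) +
L²λ_max/2) for L-Lipschitz f (`integral_exp_le_of_lipschitz`). It is proved by doubling. If X, Y are
independent copies of ω, then X + Y has the law of √2·ω, so a bound at scale s with error ε, applied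
first in Y and then in X, gives one at scale √2·s with error 2ε (`ExpMomentBound.sqrt_two_mul`). At
a small scale s, a second-order Taylor expansion gives error s²L²λ_max/2 + O(s³). Starting from s =
2^(-m/2), m doublings keep the main term and shrink the remainder to O(2^(-m/2)). Uniformity needs a
class of functions stable under averaging translates, namely `HasLipschitzGradient`; mollification
then reaches every Lipschitz f.

Applied to α f(θ + ·), this bounds the sensitivity S from above, while Jensen gives S ≥ 0. The
convexified objective equals the smoothed g plus S up to a constant, so a minimizer of the former
loses at most sup S in the latter. -/

namespace GaussianConvexification

open Filter Topology

/-! ### Functions with Lipschitz gradient, and mollification into that class. -/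

section SmoothClass

variable {E : Type*} [NormedAddCommGroup E] [NormedSpace ℝ E]

/-- Differentiable functions with derivative bounded by `L` and Lipschitz with constant `K`. -/
structure HasLipschitzGradient (L K : ℝ) (u : E → ℝ) : Prop where
  differentiable : Differentiable ℝ u
  norm_fderiv_le : ∀ x, ‖fderiv ℝ u x‖ ≤ L
  norm_fderiv_sub_le : ∀ x y, ‖fderiv ℝ u x - fderiv ℝ u y‖ ≤ K * ‖x - y‖

namespace HasLipschitzGradient

variable {L K : ℝ} {u : E → ℝ}

lemma abs_sub_le (hu : HasLipschitzGradient L K u) (x y : E) : |u x - u y| ≤ L * ‖x - y‖ := by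
  have := Convex.norm_image_sub_le_of_norm_fderiv_le (𝕜 := ℝ) (f := u) (s := Set.univ) (C := L)
    (fun z _ ↦ hu.differentiable z) (fun z _ ↦ hu.norm_fderiv_le z) convex_univ
    (Set.mem_univ y) (Set.mem_univ x)
  simpa [Real.norm_eq_abs] using this

lemma abs_le (hu : HasLipschitzGradient L K u) (x : E) :
    |u x| ≤ |u 0| + L * ‖x‖ := by
  have := hu.abs_sub_le x 0
  rw [sub_zero] at this
  linarith [abs_sub_abs_le_abs_sub (u x) (u 0)]

lemma continuous_fderiv (hu : HasLipschitzGradient L K u) : Continuous (fderiv ℝ u) := by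
  have : LipschitzWith K.toNNReal (fderiv ℝ u) := by
    refine LipschitzWith.of_dist_le_mul fun x y ↦ ?_
    rw [dist_eq_norm, dist_eq_norm]
    refine (hu.norm_fderiv_sub_le x y).trans ?_
    gcongr
    exact Real.le_coe_toNNReal K
  exact this.continuous

/-- Mean value inequality for `u - fderiv ℝ u 0` on the ball of radius `‖x‖`. The crude constant `K`
instead of `K / 2` is harmless, since it only enters terms of order `s ^ 3`. -/
lemma taylor (hu : HasLipschitzGradient L K u) (hK : 0 ≤ K) (x : E) :
    |u x - u 0 - fderiv ℝ u 0 x| ≤ K * ‖x‖ ^ 2 := by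
  have hd : ∀ z, HasFDerivAt (fun z ↦ u z - fderiv ℝ u 0 z) (fderiv ℝ u z - fderiv ℝ u 0) z :=
    fun z ↦ (hu.differentiable z).hasFDerivAt.sub (fderiv ℝ u 0).hasFDerivAt
  have := Convex.norm_image_sub_le_of_norm_hasFDerivWithin_le (𝕜 := ℝ)
    (s := Metric.closedBall (0 : E) ‖x‖) (C := K * ‖x‖)
    (fun z _ ↦ (hd z).hasFDerivWithinAt)
    (fun z hz ↦ by
      refine (hu.norm_fderiv_sub_le z 0).trans ?_
      gcongr
      simpa using hz)
    (convex_closedBall 0 _) (Metric.mem_closedBall_self (norm_nonneg _))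
    (show x ∈ Metric.closedBall (0 : E) ‖x‖ by simp)
  rw [Real.norm_eq_abs] at this
  calc |u x - u 0 - fderiv ℝ u 0 x|
      = |u x - fderiv ℝ u 0 x - (u 0 - fderiv ℝ u 0 0)| := by
        congr 1; simp; ring
    _ ≤ K * ‖x‖ * ‖x - 0‖ := this
    _ = K * ‖x‖ ^ 2 := by rw [sub_zero]; ring

lemma comp_const_add (hu : HasLipschitzGradient L K u) (a : E) :
    HasLipschitzGradient L K (fun x ↦ u (a + x)) where
  differentiable := hu.differentiable.comp (differentiable_id.const_add a)
  norm_fderiv_le x := by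
    rw [fderiv_comp_add_left]; exact hu.norm_fderiv_le _
  norm_fderiv_sub_le x y := by
    rw [fderiv_comp_add_left, fderiv_comp_add_left]
    simpa using hu.norm_fderiv_sub_le (a + x) (a + y)

variable [FiniteDimensional ℝ E] [MeasurableSpace E] [BorelSpace E]

/-- Averages of translates stay in the class. -/
lemma integral_comp_add (hu : HasLipschitzGradient L K u) {ν : Measure E} [IsProbabilityMeasure ν]
    {T : E → E} (hT : Continuous T) (hi : ∀ x, Integrable (fun y ↦ u (x + T y)) ν) :
    HasLipschitzGradient L K (fun x ↦ ∫ y, u (x + T y) ∂ν) := by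
  have hint : ∀ x, Integrable (fun y ↦ fderiv ℝ u (x + T y)) ν := fun x ↦
    Integrable.of_bound (hu.continuous_fderiv.comp (by fun_prop)).aestronglyMeasurable L
      (Eventually.of_forall fun y ↦ hu.norm_fderiv_le _)
  have hd : ∀ x, HasFDerivAt (fun x ↦ ∫ y, u (x + T y) ∂ν) (∫ y, fderiv ℝ u (x + T y) ∂ν) x := by
    intro x
    refine hasFDerivAt_integral_of_dominated_of_fderiv_le (bound := fun _ ↦ L)
      (F' := fun x y ↦ fderiv ℝ u (x + T y)) univ_mem
      (Eventually.of_forall fun z ↦ (hi z).1) (hi x) (hint x).1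
      (Eventually.of_forall fun y z _ ↦ hu.norm_fderiv_le _) (integrable_const L)
      (Eventually.of_forall fun y z _ ↦ ?_)
    exact (hasFDerivAt_comp_add_right (T y)).2 (hu.differentiable (z + T y)).hasFDerivAt
  refine ⟨fun x ↦ (hd x).differentiableAt, fun x ↦ ?_, fun x y ↦ ?_⟩
  · rw [(hd x).fderiv]
    simpa using norm_integral_le_of_norm_le_const (μ := ν)
      (Eventually.of_forall fun y ↦ hu.norm_fderiv_le (x + T y))
  · rw [(hd x).fderiv, (hd y).fderiv, ← integral_sub (hint x) (hint y)]
    simpa using norm_integral_le_of_norm_le_const (μ := ν) (C := K * ‖x - y‖)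
      (Eventually.of_forall fun z ↦ by simpa using hu.norm_fderiv_sub_le (x + T z) (y + T z))

end HasLipschitzGradient

lemma lipschitzWith_of_abs_sub_le {E : Type*} [SeminormedAddCommGroup E] {f : E → ℝ} {L : ℝ}
    (hL : 0 ≤ L) (hf : ∀ x y, |f x - f y| ≤ L * ‖x - y‖) : LipschitzWith ⟨L, hL⟩ f :=
  LipschitzWith.of_dist_le_mul fun x y ↦ by
    rw [dist_eq_norm, dist_eq_norm]; exact hf x y

variable [FiniteDimensional ℝ E] [MeasurableSpace E] [BorelSpace E]

lemma hasFDerivAt_convolution_lsmul {μ : Measure E} [μ.IsAddHaarMeasure] {ψ f : E → ℝ}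
    (hψs : HasCompactSupport ψ) (hψd : ContDiff ℝ 1 ψ) (hfc : Continuous f) (x : E) :
    HasFDerivAt (convolution ψ f (ContinuousLinearMap.lsmul ℝ ℝ) μ)
      (∫ t, f (x - t) • fderiv ℝ ψ t ∂μ) x := by
  have h := hψs.hasFDerivAt_convolution_left (μ := μ) (ContinuousLinearMap.lsmul ℝ ℝ) hψd
      hfc.locallyIntegrable x
  have h2 : convolution (fderiv ℝ ψ) f
      ((ContinuousLinearMap.lsmul ℝ ℝ : ℝ →L[ℝ] ℝ →L[ℝ] ℝ).precompL E) μ x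
      = ∫ t, f (x - t) • fderiv ℝ ψ t ∂μ := by
    rw [convolution_def]
    congr 1
    ext t v
    simp only [ContinuousLinearMap.precompL_apply, ContinuousLinearMap.lsmul_apply,
      _root_.smul_apply, smul_eq_mul]
    ring
  rw [← h2]
  exact h

/-- Averaging translates of `f` against a probability density keeps the constant `L`. For the
gradient, the derivative falls on `ψ`, leaving increments of `f` to be integrated against `fderiv ℝ
ψ`. -/
lemma hasLipschitzGradient_convolution {μ : Measure E} [μ.IsAddHaarMeasure] {ψ f : E → ℝ} {L : ℝ}
    (hψs : HasCompactSupport ψ) (hψd : ContDiff ℝ 1 ψ) (hψ0 : ∀ t, 0 ≤ ψ t)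
    (hψ1 : ∫ t, ψ t ∂μ = 1) (hL : 0 ≤ L) (hf : ∀ x y, |f x - f y| ≤ L * ‖x - y‖) :
    HasLipschitzGradient L ((∫ t, ‖fderiv ℝ ψ t‖ ∂μ) * L)
      (convolution ψ f (ContinuousLinearMap.lsmul ℝ ℝ) μ) := by
  have hfc : Continuous f := (lipschitzWith_of_abs_sub_le hL hf).continuous
  set u : E → ℝ := convolution ψ f (ContinuousLinearMap.lsmul ℝ ℝ) μ with hu
  have hu_apply : ∀ x, u x = ∫ t, ψ t * f (x - t) ∂μ := fun x ↦ by
    simp [u, convolution_def]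
  have hint : ∀ x, Integrable (fun t ↦ ψ t * f (x - t)) μ := fun x ↦
    Continuous.integrable_of_hasCompactSupport
      (hψd.continuous.mul (by fun_prop)) hψs.mul_right
  have hψi : Integrable ψ μ := hψd.continuous.integrable_of_hasCompactSupport hψs
  have hd : ∀ x, HasFDerivAt u (∫ t, f (x - t) • fderiv ℝ ψ t ∂μ) x :=
    hasFDerivAt_convolution_lsmul hψs hψd hfc
  have hψ's : HasCompactSupport (fderiv ℝ ψ) := hψs.fderiv ℝ
  have hψ'c : Continuous (fderiv ℝ ψ) := hψd.continuous_fderiv one_ne_zero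
  have hint' : ∀ x, Integrable (fun t ↦ f (x - t) • fderiv ℝ ψ t) μ := fun x ↦ by
    have hc : Continuous fun t ↦ f (x - t) := by fun_prop
    exact (hc.smul hψ'c).integrable_of_hasCompactSupport
      (hψ's.mono fun t ht ↦ by
        rw [Function.mem_support] at ht ⊢
        exact right_ne_zero_of_smul (show f (x - t) • fderiv ℝ ψ t ≠ 0 from ht))
  have hψ'i : Integrable (fun t ↦ ‖fderiv ℝ ψ t‖) μ :=
    (hψ'c.integrable_of_hasCompactSupport hψ's).norm
  have hulip : ∀ x y, |u x - u y| ≤ L * ‖x - y‖ := fun x y ↦ by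
    rw [hu_apply, hu_apply, ← integral_sub (hint x) (hint y), ← Real.norm_eq_abs]
    calc _ ≤ ∫ t, ψ t * (L * ‖x - y‖) ∂μ := by
          refine norm_integral_le_of_norm_le (hψi.mul_const _) (Eventually.of_forall fun t ↦ ?_)
          rw [← mul_sub, norm_mul, Real.norm_of_nonneg (hψ0 t), Real.norm_eq_abs]
          refine mul_le_mul_of_nonneg_left ?_ (hψ0 t)
          simpa using hf (x - t) (y - t)
      _ = L * ‖x - y‖ := by rw [integral_mul_const, hψ1, one_mul]
  refine ⟨fun x ↦ (hd x).differentiableAt, fun x ↦ ?_, fun x y ↦ ?_⟩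
  · exact norm_fderiv_le_of_lipschitz ℝ (lipschitzWith_of_abs_sub_le hL hulip)
  · rw [(hd x).fderiv, (hd y).fderiv, ← integral_sub (hint' x) (hint' y)]
    calc _ ≤ ∫ t, ‖fderiv ℝ ψ t‖ * (L * ‖x - y‖) ∂μ := by
          refine norm_integral_le_of_norm_le (hψ'i.mul_const _) (Eventually.of_forall fun t ↦ ?_)
          rw [← sub_smul, norm_smul, mul_comm, Real.norm_eq_abs]
          gcongr
          simpa using hf (x - t) (y - t)
      _ = _ := by rw [integral_mul_const]; ring

/-- A Lipschitz function is a uniform limit of functions with Lipschitz gradient and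
the same Lipschitz constant. -/
lemma exists_hasLipschitzGradient_approx {f : E → ℝ} {L : ℝ} (hL : 0 ≤ L)
    (hf : ∀ x y, |f x - f y| ≤ L * ‖x - y‖) {δ : ℝ} (hδ : 0 < δ) :
    ∃ K, 0 ≤ K ∧ ∃ u : E → ℝ, HasLipschitzGradient L K u ∧ ∀ x, |u x - f x| ≤ L * δ := by
  have hfc : Continuous f := (lipschitzWith_of_abs_sub_le hL hf).continuous
  let φ : ContDiffBump (0 : E) := ⟨δ / 2, δ, by positivity, by linarith⟩
  refine ⟨_, ?_, _, hasLipschitzGradient_convolution (μ := Measure.addHaar)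
    φ.hasCompactSupport_normed φ.contDiff_normed φ.nonneg_normed φ.integral_normed hL hf,
    fun x ↦ ?_⟩
  · exact mul_nonneg (integral_nonneg fun _ ↦ norm_nonneg _) hL
  · refine φ.dist_normed_convolution_le hfc.aestronglyMeasurable fun y hy ↦ ?_
    rw [Real.dist_eq]
    refine (hf y x).trans ?_
    gcongr
    rw [← dist_eq_norm]
    exact (Metric.mem_ball.1 hy).le

end SmoothClass

/-! ### Gaussian exponential moments by doubling. -/

section Concentration

lemma exp_le_taylor_two (x : ℝ) :
    Real.exp x ≤ 1 + x + x ^ 2 / 2 + |x| ^ 3 * Real.exp |x| := by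
  have h := Complex.norm_exp_sub_sum_le_norm_mul_exp (x : ℂ) 3
  have h2 : Complex.exp (x : ℂ) - ∑ m ∈ Finset.range 3, (x : ℂ) ^ m / (m.factorial : ℂ)
      = ((Real.exp x - (1 + x + x ^ 2 / 2) : ℝ) : ℂ) := by
    simp [Finset.sum_range_succ]
  rw [h2, Complex.norm_real, Complex.norm_real, Real.norm_eq_abs, Real.norm_eq_abs] at h
  linarith [le_abs_self (Real.exp x - (1 + x + x ^ 2 / 2))]

variable {E : Type*} [NormedAddCommGroup E] [NormedSpace ℝ E] [FiniteDimensional ℝ E]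
  [MeasurableSpace E] [BorelSpace E] {μ : Measure E} [IsGaussian μ]

/-- Fernique's theorem supplies integrability of `exp (a * ‖x‖ ^ 2)` for some `a > 0`; completing
the square dominates the linear exponent. -/
lemma integrable_exp_mul_norm (c : ℝ) : Integrable (fun x ↦ Real.exp (c * ‖x‖)) μ := by
  have : CompleteSpace E := FiniteDimensional.complete ℝ E
  have : SecondCountableTopology E :=
    have := FiniteDimensional.proper_real E
    inferInstance
  obtain ⟨a, ha, hi⟩ := IsGaussian.exists_integrable_exp_sq μ
  refine (hi.const_mul (Real.exp (c ^ 2 / (4 * a)))).mono' (by fun_prop)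
    (Eventually.of_forall fun x ↦ ?_)
  rw [Real.norm_of_nonneg (Real.exp_nonneg _), ← Real.exp_add]
  gcongr
  have : c ^ 2 / (4 * a) + a * ‖x‖ ^ 2 - c * ‖x‖ = (2 * a * ‖x‖ - c) ^ 2 / (4 * a) := by
    field_simp; ring
  have : 0 ≤ (2 * a * ‖x‖ - c) ^ 2 / (4 * a) := by positivity
  linarith

lemma integrable_exp_of_abs_le {h : E → ℝ} (hc : Continuous h) {a b : ℝ}
    (hb : ∀ x, |h x| ≤ a + b * ‖x‖) : Integrable (fun x ↦ Real.exp (h x)) μ := by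
  refine ((integrable_exp_mul_norm b).const_mul (Real.exp a)).mono' (by fun_prop)
    (Eventually.of_forall fun x ↦ ?_)
  rw [Real.norm_of_nonneg (Real.exp_nonneg _), ← Real.exp_add]
  gcongr
  exact (le_abs_self _).trans (hb x)

lemma integrable_norm_pow_mul_exp (n : ℕ) (c : ℝ) :
    Integrable (fun x ↦ ‖x‖ ^ n * Real.exp (c * ‖x‖)) μ := by
  refine ((integrable_exp_mul_norm (1 + c)).const_mul (n.factorial : ℝ)).mono' (by fun_prop)
    (Eventually.of_forall fun x ↦ ?_)
  have h := Real.pow_div_factorial_le_exp ‖x‖ (norm_nonneg x) n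
  rw [div_le_iff₀ (by positivity)] at h
  rw [Real.norm_of_nonneg (by positivity), add_mul, one_mul, Real.exp_add, ← mul_assoc,
    mul_comm (n.factorial : ℝ)]
  gcongr

lemma integrable_norm_pow (n : ℕ) : Integrable (fun x ↦ ‖x‖ ^ n) μ := by
  simpa using integrable_norm_pow_mul_exp (μ := μ) n 0

lemma integrable_of_abs_le {h : E → ℝ} (hc : Continuous h) {a b : ℝ}
    (hb : ∀ x, |h x| ≤ a + b * ‖x‖) : Integrable h μ := by
  have := integrable_norm_pow (μ := μ) 1
  simp only [pow_one] at this
  exact ((integrable_const a).add (this.const_mul b)).mono' hc.aestronglyMeasurable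
    (Eventually.of_forall hb)

/-- The sum of two independent copies of a centered Gaussian vector is a rescaling by `√2`. -/
lemma measurePreserving_add_smul (hμ : μ[id] = 0) :
    MeasurePreserving (fun p : E × E ↦ (√2)⁻¹ • (p.1 + p.2)) (μ.prod μ) μ := by
  have : CompleteSpace E := FiniteDimensional.complete ℝ E
  have : SecondCountableTopology E :=
    have := FiniteDimensional.proper_real E
    inferInstance
  have hr : MeasurePreserving (ContinuousLinearMap.rotation (E := E) (Real.pi / 4))
      (μ.prod μ) (μ.prod μ) :=
    ⟨by fun_prop, IsGaussian.map_rotation_eq_self hμ _⟩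
  -- The map is the first coordinate of the rotation by π/4, which preserves the product of a
  -- centered Gaussian with itself.
  convert measurePreserving_fst.comp hr using 1
  ext p
  have : (√2)⁻¹ = √2 / 2 := by
    rw [inv_eq_iff_eq_inv, inv_div, eq_div_iff (by positivity)]; simp
  simp [ContinuousLinearMap.rotation_apply, this, smul_add]

variable {L K lam : ℝ}

lemma HasLipschitzGradient.integrable_smul {u : E → ℝ} (hu : HasLipschitzGradient L K u) (s : ℝ)
    (a : E) : Integrable (fun x ↦ u (a + s • x)) μ := by
  refine integrable_of_abs_le (a := |u a|) (b := L * |s|)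
    (hu.differentiable.continuous.comp (by fun_prop)) fun x ↦ ?_
  have := (hu.comp_const_add a).abs_le (s • x)
  rw [norm_smul, Real.norm_eq_abs, add_zero] at this
  linarith

lemma HasLipschitzGradient.integrable_exp_smul {u : E → ℝ} (hu : HasLipschitzGradient L K u)
    (s : ℝ) (a : E) : Integrable (fun x ↦ Real.exp (u (a + s • x))) μ := by
  refine integrable_exp_of_abs_le (a := |u a|) (b := L * |s|)
    (hu.differentiable.continuous.comp (by fun_prop)) fun x ↦ ?_
  have := (hu.comp_const_add a).abs_le (s • x)
  rw [norm_smul, Real.norm_eq_abs, add_zero] at this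
  linarith

/-- The exponential moment bound with error `ε` at scale `s`, uniform over the class of
functions with Lipschitz gradient. -/
def ExpMomentBound (μ : Measure E) (L K s ε : ℝ) : Prop :=
  ∀ u : E → ℝ, HasLipschitzGradient L K u →
    ∫ x, Real.exp (u (s • x)) ∂μ ≤ Real.exp (∫ x, u (s • x) ∂μ + ε)

/-- For fixed `x` the hypothesis bounds the integral over `y` of `exp (u (s • x + s • y))`. The
resulting mean, as a function of `s • x`, is again in the class with the same `L` and `K`, so the
hypothesis applies once more and the two errors add. -/
lemma ExpMomentBound.sqrt_two_mul (hμ : μ[id] = 0) {s ε : ℝ}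
    (h : ExpMomentBound μ L K s ε) : ExpMomentBound μ L K (√2 * s) (2 * ε) := by
  intro u hu
  have hcont := hu.differentiable.continuous
  have hmp := measurePreserving_add_smul hμ
  have hscale : ∀ p : E × E, (√2 * s) • ((√2)⁻¹ • (p.1 + p.2)) = s • p.1 + s • p.2 := fun p ↦ by
    rw [smul_smul, mul_comm √2 s, mul_assoc, mul_inv_cancel₀ (by positivity), mul_one, smul_add]
  have htrans : ∀ g : E → ℝ, Continuous g →
      Integrable (fun x ↦ g ((√2 * s) • x)) μ →
      Integrable (fun p : E × E ↦ g (s • p.1 + s • p.2)) (μ.prod μ) ∧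
      ∫ x, g ((√2 * s) • x) ∂μ = ∫ x, ∫ y, g (s • x + s • y) ∂μ ∂μ := by
    intro g hg hi
    have h1 : Integrable (fun p : E × E ↦ g (s • p.1 + s • p.2)) (μ.prod μ) := by
      have := hmp.integrable_comp_of_integrable hi
      simpa only [Function.comp_def, hscale] using this
    refine ⟨h1, ?_⟩
    rw [← integral_prod _ h1, ← hmp.map_eq, integral_map hmp.measurable.aemeasurable
      (by fun_prop)]
    rw [hmp.map_eq]
    simp only [hscale]
  have hie : Integrable (fun x ↦ Real.exp (u ((√2 * s) • x))) μ := by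
    simpa using hu.integrable_exp_smul (μ := μ) (√2 * s) 0
  have hiu : Integrable (fun x ↦ u ((√2 * s) • x)) μ := by
    simpa using hu.integrable_smul (μ := μ) (√2 * s) 0
  obtain ⟨hpe, hee⟩ := htrans (fun x ↦ Real.exp (u x)) (by fun_prop) hie
  obtain ⟨-, heu⟩ := htrans u hcont hiu
  have hv : HasLipschitzGradient L K (fun x ↦ ∫ y, u (x + s • y) ∂μ) :=
    hu.integral_comp_add (by fun_prop) fun x ↦ hu.integrable_smul s x
  rw [hee, heu]
  calc ∫ x, ∫ y, Real.exp (u (s • x + s • y)) ∂μ ∂μ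
      ≤ ∫ x, Real.exp (∫ y, u (s • x + s • y) ∂μ) * Real.exp ε ∂μ := by
        refine integral_mono hpe.integral_prod_left ?_ fun x ↦ ?_
        · have := hv.integrable_exp_smul (μ := μ) s 0
          simp only [zero_add] at this
          exact this.mul_const _
        · rw [← Real.exp_add]
          exact h _ (hu.comp_const_add (s • x))
    _ = (∫ x, Real.exp (∫ y, u (s • x + s • y) ∂μ) ∂μ) * Real.exp ε := integral_mul_const _ _
    _ ≤ Real.exp (∫ x, ∫ y, u (s • x + s • y) ∂μ ∂μ + ε) * Real.exp ε := by
        gcongr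
        exact h _ hv
    _ = _ := by rw [← Real.exp_add]; ring_nf

lemma ExpMomentBound.sqrt_two_pow_mul (hμ : μ[id] = 0) {s ε : ℝ}
    (h : ExpMomentBound μ L K s ε) (m : ℕ) :
    ExpMomentBound μ L K (√2 ^ m * s) (2 ^ m * ε) := by
  induction m with
  | zero => simpa using h
  | succ m ih =>
    rw [pow_succ', pow_succ', mul_assoc, mul_assoc]
    exact ih.sqrt_two_mul hμ

/-- Second-order Taylor bound for the exponential moment at a small scale. -/
lemma exists_expMomentBound_small (hlam : ∀ l : StrongDual ℝ E, ∫ x, l x ^ 2 ∂μ ≤ lam * ‖l‖ ^ 2)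
    (hlam0 : 0 ≤ lam) (hL : 0 ≤ L) (hK : 0 ≤ K) :
    ∃ B, ∀ s, 0 ≤ s → s ≤ 1 → ExpMomentBound μ L K s (s ^ 2 * (L ^ 2 * lam / 2) + s ^ 3 * B) := by
  set M : ℝ := ∫ x, ‖x‖ ∂μ with hM
  have hM0 : 0 ≤ M := integral_nonneg fun _ ↦ norm_nonneg _
  have hi3 := integrable_norm_pow (μ := μ) 3
  have hi4 := integrable_norm_pow (μ := μ) 4
  have hi1 : Integrable (fun x ↦ ‖x‖) μ := by simpa using integrable_norm_pow (μ := μ) 1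
  have hW : Integrable (fun x ↦ (L * (‖x‖ + M)) ^ 3 * Real.exp (L * (‖x‖ + M))) μ := by
    have h := ((integrable_norm_pow_mul_exp (μ := μ) 3 L).add
      (((integrable_norm_pow_mul_exp (μ := μ) 2 L).const_mul (3 * M)).add
      (((integrable_norm_pow_mul_exp (μ := μ) 1 L).const_mul (3 * M ^ 2)).add
      ((integrable_norm_pow_mul_exp (μ := μ) 0 L).const_mul (M ^ 3))))).const_mul
        (L ^ 3 * Real.exp (L * M))
    refine h.congr (Eventually.of_forall fun x ↦ ?_)
    simp only [Pi.add_apply, mul_add, Real.exp_add]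
    ring
  set A : ℝ := ∫ x, (L * (‖x‖ + M)) ^ 3 * Real.exp (L * (‖x‖ + M)) ∂μ with hA
  set Q : ℝ := ∫ x, (2 * L * K * ‖x‖ ^ 3 + K ^ 2 * ‖x‖ ^ 4) ∂μ with hQ
  have hQi : Integrable (fun x ↦ 2 * L * K * ‖x‖ ^ 3 + K ^ 2 * ‖x‖ ^ 4) μ :=
    (hi3.const_mul _).add (hi4.const_mul _)
  -- `A` pays for the cubic remainder of the exponential, `Q / 2` for the Taylor error of `u` in the
  -- second moment; neither depends on `u` or `s`.
  refine ⟨A + Q / 2, fun s hs0 hs1 u hu ↦ ?_⟩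
  have hcont := hu.differentiable.continuous
  have hiu : Integrable (fun x ↦ u (s • x)) μ := by
    simpa using hu.integrable_smul (μ := μ) s 0
  have hie : Integrable (fun x ↦ Real.exp (u (s • x))) μ := by
    simpa using hu.integrable_exp_smul (μ := μ) s 0
  set m : ℝ := ∫ x, u (s • x) ∂μ with hm
  have hsn : ∀ x : E, ‖s • x‖ = s * ‖x‖ := fun x ↦ by rw [norm_smul, Real.norm_of_nonneg hs0]
  have hu0 : ∀ x, |u (s • x) - u 0| ≤ s * (L * ‖x‖) := fun x ↦ by
    have := hu.abs_sub_le (s • x) 0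
    rw [sub_zero, hsn] at this
    linarith
  have hm0 : |u 0 - m| ≤ s * (L * M) := by
    have h1 : u 0 - m = ∫ x, (u 0 - u (s • x)) ∂μ := by
      rw [integral_sub (integrable_const _) hiu]; simp [hm]
    rw [h1, ← Real.norm_eq_abs, hM, ← integral_const_mul, ← integral_const_mul]
    refine norm_integral_le_of_norm_le ((hi1.const_mul L).const_mul s)
      (Eventually.of_forall fun x ↦ ?_)
    rw [Real.norm_eq_abs, abs_sub_comm]
    exact hu0 x
  have hD : ∀ x, |u (s • x) - m| ≤ s * (L * (‖x‖ + M)) := fun x ↦ by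
    have := abs_sub_le (u (s • x)) (u 0) m
    linarith [hu0 x]
  have hremainder : ∀ x, |u (s • x) - m| ^ 3 * Real.exp |u (s • x) - m|
      ≤ s ^ 3 * ((L * (‖x‖ + M)) ^ 3 * Real.exp (L * (‖x‖ + M))) := fun x ↦ by
    have hW0 : 0 ≤ L * (‖x‖ + M) := by positivity
    calc _ ≤ (s * (L * (‖x‖ + M))) ^ 3 * Real.exp (L * (‖x‖ + M)) := by
          gcongr
          · exact hD x
          · exact (hD x).trans (mul_le_of_le_one_left hW0 hs1)
      _ = _ := by ring
  have hsq : ∀ x, (u (s • x) - u 0) ^ 2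
      ≤ s ^ 2 * fderiv ℝ u 0 x ^ 2 + s ^ 3 * (2 * L * K * ‖x‖ ^ 3 + K ^ 2 * ‖x‖ ^ 4) := fun x ↦ by
    have ht := hu.taylor hK (s • x)
    rw [hsn, map_smul, smul_eq_mul] at ht
    set l := fderiv ℝ u 0 x
    have hl : |l| ≤ L * ‖x‖ := (ContinuousLinearMap.le_opNorm _ _).trans
      (mul_le_mul_of_nonneg_right (hu.norm_fderiv_le 0) (norm_nonneg _))
    set r := u (s • x) - u 0 - s * l with hr
    have hdec : u (s • x) - u 0 = s * l + r := by rw [hr]; ring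
    have h1 : s * (l * r) ≤ s * ((L * ‖x‖) * (K * (s * ‖x‖) ^ 2)) := by
      refine mul_le_mul_of_nonneg_left ?_ hs0
      calc l * r ≤ |l * r| := le_abs_self _
        _ = |l| * |r| := abs_mul _ _
        _ ≤ _ := mul_le_mul hl ht (abs_nonneg _) (by positivity)
    have h2 : r ^ 2 ≤ (K * (s * ‖x‖) ^ 2) ^ 2 := sq_le_sq' (by linarith [neg_abs_le r])
      ((le_abs_self r).trans ht)
    have h3 : s ^ 4 * (K ^ 2 * ‖x‖ ^ 4) ≤ s ^ 3 * (K ^ 2 * ‖x‖ ^ 4) := by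
      gcongr ?_ * _
      exact pow_le_pow_of_le_one hs0 hs1 (by norm_num)
    rw [hdec]
    nlinarith
  have hl2 : Integrable (fun x ↦ fderiv ℝ u 0 x ^ 2) μ := by
    refine ((integrable_norm_pow (μ := μ) 2).const_mul (L ^ 2)).mono' (by fun_prop)
      (Eventually.of_forall fun x ↦ ?_)
    rw [norm_pow, ← mul_pow]
    gcongr
    exact (ContinuousLinearMap.le_opNorm _ _).trans (by gcongr; exact hu.norm_fderiv_le 0)
  have hsqi : Integrable (fun x ↦ (u (s • x) - u 0) ^ 2) μ :=
    ((hl2.const_mul (s ^ 2)).add (hQi.const_mul (s ^ 3))).mono' (by fun_prop)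
      (Eventually.of_forall fun x ↦ by
        rw [Real.norm_of_nonneg (sq_nonneg _)]; exact hsq x)
  have hsqint : ∫ x, (u (s • x) - u 0) ^ 2 ∂μ ≤ s ^ 2 * (L ^ 2 * lam) + s ^ 3 * Q := by
    calc _ ≤ ∫ x, (s ^ 2 * fderiv ℝ u 0 x ^ 2
              + s ^ 3 * (2 * L * K * ‖x‖ ^ 3 + K ^ 2 * ‖x‖ ^ 4)) ∂μ :=
          integral_mono hsqi ((hl2.const_mul (s ^ 2)).add (hQi.const_mul (s ^ 3))) hsq
      _ = s ^ 2 * ∫ x, fderiv ℝ u 0 x ^ 2 ∂μ + s ^ 3 * Q := by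
          rw [integral_add (hl2.const_mul (s ^ 2)) (hQi.const_mul (s ^ 3)), integral_const_mul,
            integral_const_mul]
      _ ≤ s ^ 2 * (lam * L ^ 2) + s ^ 3 * Q := by
          gcongr
          refine (hlam _).trans ?_
          gcongr
          exact hu.norm_fderiv_le 0
      _ = _ := by ring
  -- replacing the mean by `u 0` can only increase the second moment
  have hquad : ∀ x, (u (s • x) - m) ^ 2
      = (u (s • x) - u 0) ^ 2 - 2 * (m - u 0) * u (s • x) + (m ^ 2 - u 0 ^ 2) := fun x ↦ by ring
  have hvi : Integrable (fun x ↦ (u (s • x) - m) ^ 2) μ := by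
    simp only [hquad]
    exact (hsqi.sub (hiu.const_mul _)).add (integrable_const _)
  have hvi' : Integrable (fun x ↦ (u (s • x) - u 0) ^ 2 - 2 * (m - u 0) * u (s • x)) μ :=
    hsqi.sub (hiu.const_mul _)
  have hvar : ∫ x, (u (s • x) - m) ^ 2 ∂μ ≤ ∫ x, (u (s • x) - u 0) ^ 2 ∂μ := by
    simp only [hquad]
    rw [integral_add hvi' (integrable_const _),
      integral_sub hsqi (hiu.const_mul _), integral_const_mul, ← hm]
    simp only [integral_const, probReal_univ, smul_eq_mul, one_mul]
    nlinarith [sq_nonneg (m - u 0)]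
  have hci : Integrable (fun x ↦ u (s • x) - m) μ := hiu.sub (integrable_const m)
  have hc0 : ∫ x, (u (s • x) - m) ∂μ = 0 := by
    rw [integral_sub hiu (integrable_const m)]; simp [hm]
  have hdom : ∀ x, Real.exp (u (s • x) - m) ≤ 1 + (u (s • x) - m) + (u (s • x) - m) ^ 2 / 2
      + s ^ 3 * ((L * (‖x‖ + M)) ^ 3 * Real.exp (L * (‖x‖ + M))) := fun x ↦
    (exp_le_taylor_two _).trans (add_le_add_right (hremainder x) _)
  have hbound : ∫ x, Real.exp (u (s • x) - m) ∂μ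
      ≤ 1 + (s ^ 2 * (L ^ 2 * lam / 2) + s ^ 3 * (A + Q / 2)) := by
    have hei : Integrable (fun x ↦ Real.exp (u (s • x) - m)) μ := by
      simp only [Real.exp_sub]; exact hie.div_const _
    have i1 : Integrable (fun x ↦ 1 + (u (s • x) - m)) μ := (integrable_const 1).add hci
    have i2 : Integrable (fun x ↦ 1 + (u (s • x) - m) + (u (s • x) - m) ^ 2 / 2) μ :=
      i1.add (hvi.div_const 2)
    refine (integral_mono hei (i2.add (hW.const_mul (s ^ 3))) hdom).trans ?_
    simp only [Pi.add_apply]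
    rw [integral_add i2 (hW.const_mul (s ^ 3)), integral_add i1 (hvi.div_const 2),
      integral_add (integrable_const 1) hci, hc0, integral_const_mul, integral_div, ← hA]
    simp only [integral_const, probReal_univ, smul_eq_mul, one_mul]
    linarith
  have hsplit : ∫ x, Real.exp (u (s • x)) ∂μ
      = Real.exp m * ∫ x, Real.exp (u (s • x) - m) ∂μ := by
    rw [← integral_const_mul]
    congr 1 with x
    rw [← Real.exp_add]; ring_nf
  rw [hsplit, Real.exp_add]
  gcongr
  refine hbound.trans ?_
  linarith [Real.add_one_le_exp (s ^ 2 * (L ^ 2 * lam / 2) + s ^ 3 * (A + Q / 2))]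

/-- Start at scale `(√2)⁻¹ ^ m` and double `m` times: the quadratic term is unchanged because `2 ^ m
* s ^ 2 = 1`, while the cubic one becomes `(√2)⁻¹ ^ m * B` and vanishes as `m → ∞`. -/
lemma expMomentBound_one (hμ : μ[id] = 0)
    (hlam : ∀ l : StrongDual ℝ E, ∫ x, l x ^ 2 ∂μ ≤ lam * ‖l‖ ^ 2)
    (hlam0 : 0 ≤ lam) (hL : 0 ≤ L) (hK : 0 ≤ K) :
    ExpMomentBound μ L K 1 (L ^ 2 * lam / 2) := by
  obtain ⟨B, hB⟩ := exists_expMomentBound_small (L := L) (K := K) hlam hlam0 hL hK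
  intro u hu
  have hsq : (√2)⁻¹ ^ 2 = 2⁻¹ := by rw [inv_pow, Real.sq_sqrt (by norm_num)]
  have hlt : (√2)⁻¹ < 1 := inv_lt_one_of_one_lt₀ (by
    rw [Real.lt_sqrt (by norm_num)]; norm_num)
  have key : ∀ m : ℕ, ∫ x, Real.exp (u ((1 : ℝ) • x)) ∂μ
      ≤ Real.exp (∫ x, u ((1 : ℝ) • x) ∂μ + (L ^ 2 * lam / 2 + ((√2)⁻¹) ^ m * B)) := by
    intro m
    have h := (hB ((√2)⁻¹ ^ m) (by positivity) (pow_le_one₀ (by positivity) hlt.le)).sqrt_two_pow_mul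
      hμ m
    have h1 : √2 ^ m * (√2)⁻¹ ^ m = 1 := by
      rw [← mul_pow, mul_inv_cancel₀ (by positivity), one_pow]
    have h2 : (2 : ℝ) ^ m * ((√2)⁻¹ ^ m) ^ 2 = 1 := by
      rw [← pow_mul, mul_comm m 2, pow_mul, hsq, ← mul_pow]; norm_num
    have h3 : (2 : ℝ) ^ m * (((√2)⁻¹ ^ m) ^ 2 * (L ^ 2 * lam / 2) + ((√2)⁻¹ ^ m) ^ 3 * B)
        = L ^ 2 * lam / 2 + (√2)⁻¹ ^ m * B := by
      linear_combination (L ^ 2 * lam / 2 + (√2)⁻¹ ^ m * B) * h2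
    rw [h1, h3] at h
    exact h u hu
  have hlim : Tendsto (fun m : ℕ ↦ Real.exp (∫ x, u ((1 : ℝ) • x) ∂μ
      + (L ^ 2 * lam / 2 + ((√2)⁻¹) ^ m * B))) atTop
      (𝓝 (Real.exp (∫ x, u ((1 : ℝ) • x) ∂μ + (L ^ 2 * lam / 2 + 0 * B)))) := by
    refine (Real.continuous_exp.tendsto _).comp (tendsto_const_nhds.add (tendsto_const_nhds.add ?_))
    exact (tendsto_pow_atTop_nhds_zero_of_lt_one (by positivity) hlt).mul_const B
  have := ge_of_tendsto' hlim key
  simpa using this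

/-- **Gaussian concentration with the sharp constant** for Lipschitz functions. -/
theorem integral_exp_le_of_lipschitz (hμ : μ[id] = 0)
    (hlam : ∀ l : StrongDual ℝ E, ∫ x, l x ^ 2 ∂μ ≤ lam * ‖l‖ ^ 2)
    (hlam0 : 0 ≤ lam) (hL : 0 ≤ L) {f : E → ℝ} (hf : ∀ x y, |f x - f y| ≤ L * ‖x - y‖) :
    ∫ x, Real.exp (f x) ∂μ ≤ Real.exp (∫ x, f x ∂μ + L ^ 2 * lam / 2) := by
  have hfc : Continuous f := (lipschitzWith_of_abs_sub_le hL hf).continuous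
  have hfb : ∀ x, |f x| ≤ |f 0| + L * ‖x‖ := fun x ↦ by
    have := hf x 0
    rw [sub_zero] at this
    linarith [abs_sub_abs_le_abs_sub (f x) (f 0)]
  have hfi : Integrable f μ := integrable_of_abs_le hfc hfb
  have hfe : Integrable (fun x ↦ Real.exp (f x)) μ := integrable_exp_of_abs_le hfc hfb
  -- Replacing `f` by its mollification costs `L * δ` twice, once inside the exponential and once in
  -- the mean.
  have key : ∀ δ : ℝ, 0 < δ → ∫ x, Real.exp (f x) ∂μ
      ≤ Real.exp (∫ x, f x ∂μ + L ^ 2 * lam / 2 + 2 * (L * δ)) := by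
    intro δ hδ
    obtain ⟨K, hK, u, hu, hclose⟩ := exists_hasLipschitzGradient_approx hL hf hδ
    have hui : Integrable u μ := by simpa using hu.integrable_smul (μ := μ) 1 0
    have hue : Integrable (fun x ↦ Real.exp (u x)) μ := by
      simpa using hu.integrable_exp_smul (μ := μ) 1 0
    have h := expMomentBound_one hμ hlam hlam0 hL hK u hu
    simp only [one_smul] at h
    have hmean : ∫ x, u x ∂μ ≤ ∫ x, f x ∂μ + L * δ := by
      calc ∫ x, u x ∂μ ≤ ∫ x, (f x + L * δ) ∂μ :=
            integral_mono hui (hfi.add (integrable_const _)) fun x ↦ by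
              linarith [(abs_le.1 (hclose x)).2]
        _ = _ := by rw [integral_add hfi (integrable_const _)]; simp
    calc ∫ x, Real.exp (f x) ∂μ ≤ ∫ x, Real.exp (L * δ) * Real.exp (u x) ∂μ := by
          refine integral_mono hfe (hue.const_mul _) fun x ↦ ?_
          rw [← Real.exp_add]
          exact Real.exp_le_exp.2 (by linarith [(abs_le.1 (hclose x)).1])
      _ = Real.exp (L * δ) * ∫ x, Real.exp (u x) ∂μ := integral_const_mul _ _
      _ ≤ Real.exp (L * δ) * Real.exp (∫ x, u x ∂μ + L ^ 2 * lam / 2) := by gcongr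
      _ ≤ _ := by
          rw [← Real.exp_add]
          exact Real.exp_le_exp.2 (by linarith)
  have hlim : Tendsto (fun δ : ℝ ↦ Real.exp (∫ x, f x ∂μ + L ^ 2 * lam / 2 + 2 * (L * δ)))
      (𝓝[>] 0) (𝓝 (Real.exp (∫ x, f x ∂μ + L ^ 2 * lam / 2 + 2 * (L * 0)))) :=
    (Continuous.tendsto (by fun_prop) 0).mono_left nhdsWithin_le_nhds
  have := ge_of_tendsto hlim (eventually_mem_nhdsWithin.mono fun δ hδ ↦ key δ hδ)
  simpa using this

end Concentration

/-! ### Quadratic forms and the Gaussian covariance. -/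

variable {k : ℕ}

open RealInnerProductSpace in
lemma quadForm_eq_inner (A : Matrix (Fin k) (Fin k) ℝ) (x : EuclideanSpace ℝ (Fin k)) :
    quadForm A x = ⟪x, toEuclideanCLM (𝕜 := ℝ) A x⟫ := by
  simp [quadForm, EuclideanSpace.inner_eq_star_dotProduct, ofLp_toEuclideanCLM, dotProduct_comm]

lemma lambdaMax_nonneg {S : Matrix (Fin k) (Fin k) ℝ} (hS : S.PosSemidef) :
    0 ≤ lambdaMax hS.isHermitian :=
  Real.iSup_nonneg fun i ↦ hS.eigenvalues_nonneg i

open RealInnerProductSpace in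
/-- The quadratic form is bounded by the largest eigenvalue. -/
lemma quadForm_le_lambdaMax {A : Matrix (Fin k) (Fin k) ℝ} (hA : A.IsHermitian)
    (x : EuclideanSpace ℝ (Fin k)) : quadForm A x ≤ lambdaMax hA * ‖x‖ ^ 2 := by
  set b := hA.eigenvectorBasis
  have hTb : ∀ i, toEuclideanCLM (𝕜 := ℝ) A (b i) = hA.eigenvalues i • b i := fun i ↦ by
    apply WithLp.ofLp_injective
    rw [ofLp_toEuclideanCLM, hA.mulVec_eigenvectorBasis]
    rfl
  have hsymm : ∀ y z, ⟪toEuclideanCLM (𝕜 := ℝ) A y, z⟫ = ⟪y, toEuclideanCLM (𝕜 := ℝ) A z⟫ :=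
    (isSymmetric_toEuclideanLin_iff (𝕜 := ℝ)).2 hA
  rw [quadForm_eq_inner, ← b.sum_inner_mul_inner, ← b.sum_sq_norm_inner_right x, Finset.mul_sum]
  refine Finset.sum_le_sum fun i _ ↦ ?_
  rw [← hsymm, hTb, real_inner_smul_left, real_inner_comm, Real.norm_eq_abs, sq_abs]
  have : hA.eigenvalues i ≤ lambdaMax hA := le_ciSup (Set.finite_range _).bddAbove i
  nlinarith [sq_nonneg ⟪b i, x⟫]

open RealInnerProductSpace in
-- By Riesz representation `l` is the inner product with some `v`, whose second moment is the
-- covariance form `vᵀ S v`.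
lemma integral_dual_sq_le {S : Matrix (Fin k) (Fin k) ℝ} (hS : S.PosSemidef)
    (l : StrongDual ℝ (EuclideanSpace ℝ (Fin k))) :
    ∫ x, l x ^ 2 ∂(multivariateGaussian 0 S) ≤ lambdaMax hS.isHermitian * ‖l‖ ^ 2 := by
  obtain ⟨v, rfl⟩ := (InnerProductSpace.toDual ℝ (EuclideanSpace ℝ (Fin k))).surjective l
  have h := covarianceBilin_multivariateGaussian (μ := 0) hS v v
  rw [covarianceBilin_apply IsGaussian.memLp_two_id, integral_id_multivariateGaussian'] at h
  simp only [InnerProductSpace.toDual_apply_apply, LinearIsometryEquiv.norm_map, sq]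
  simp only [sub_zero] at h
  rw [h, ← sq]
  exact quadForm_le_lambdaMax hS.isHermitian v

/-! ### Smoothed objectives and the sensitivity function. -/

section Smoothing

variable {f : EuclideanSpace ℝ (Fin k) → ℝ} {L : ℝ} {S : Matrix (Fin k) (Fin k) ℝ}

/-- For `k = 0` the Lipschitz hypothesis does not force `0 ≤ L`; passing to `|L|` covers that case,
and the final bounds only see `L ^ 2`. -/
lemma abs_sub_le_abs_mul (hf : ∀ θ θ' : EuclideanSpace ℝ (Fin k), |f θ - f θ'| ≤ L * ‖θ - θ'‖)
    (θ θ' : EuclideanSpace ℝ (Fin k)) : |f θ - f θ'| ≤ |L| * ‖θ - θ'‖ :=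
  (hf θ θ').trans (by gcongr; exact le_abs_self L)

lemma abs_shift_le (hf : ∀ θ θ' : EuclideanSpace ℝ (Fin k), |f θ - f θ'| ≤ L * ‖θ - θ'‖)
    (θ ω : EuclideanSpace ℝ (Fin k)) : |f (θ + ω)| ≤ |f θ| + L * ‖ω‖ := by
  have := hf (θ + ω) θ
  rw [add_sub_cancel_left] at this
  linarith [abs_sub_abs_le_abs_sub (f (θ + ω)) (f θ)]

lemma continuous_of_abs_sub_le
    (hf : ∀ θ θ' : EuclideanSpace ℝ (Fin k), |f θ - f θ'| ≤ L * ‖θ - θ'‖) : Continuous f :=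
  (lipschitzWith_of_abs_sub_le (abs_nonneg L) (abs_sub_le_abs_mul hf)).continuous

lemma integrable_shift (hf : ∀ θ θ' : EuclideanSpace ℝ (Fin k), |f θ - f θ'| ≤ L * ‖θ - θ'‖)
    (θ : EuclideanSpace ℝ (Fin k)) :
    Integrable (fun ω ↦ f (θ + ω)) (multivariateGaussian 0 S) :=
  integrable_of_abs_le ((continuous_of_abs_sub_le hf).comp (by fun_prop)) (abs_shift_le hf θ)

lemma integrable_exp_shift (hf : ∀ θ θ' : EuclideanSpace ℝ (Fin k), |f θ - f θ'| ≤ L * ‖θ - θ'‖)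
    (α : ℝ) (θ : EuclideanSpace ℝ (Fin k)) :
    Integrable (fun ω ↦ Real.exp (α * f (θ + ω))) (multivariateGaussian 0 S) := by
  have hc := continuous_of_abs_sub_le hf
  refine integrable_exp_of_abs_le (a := |α| * |f θ|) (b := |α| * L) (by fun_prop) fun ω ↦ ?_
  rw [abs_mul, mul_assoc, ← mul_add]
  gcongr
  exact abs_shift_le hf θ ω

lemma integrable_quadForm (R : Matrix (Fin k) (Fin k) ℝ) :
    Integrable (quadForm R) (multivariateGaussian 0 S) := by
  simp only [funext (quadForm_eq_inner R)]
  refine ((integrable_norm_pow 2).const_mul ‖toEuclideanCLM (𝕜 := ℝ) R‖).mono'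
    (by fun_prop) (.of_forall fun x ↦ ?_)
  calc _ ≤ ‖x‖ * ‖toEuclideanCLM (𝕜 := ℝ) R x‖ := norm_inner_le_norm _ _
    _ ≤ ‖x‖ * (‖toEuclideanCLM (𝕜 := ℝ) R‖ * ‖x‖) := by
        gcongr; exact ContinuousLinearMap.le_opNorm _ _
    _ = _ := by ring

/-- The polarization of the quadratic form at `θ`. -/
noncomputable def quadFormPolar (R : Matrix (Fin k) (Fin k) ℝ) (θ : EuclideanSpace ℝ (Fin k)) :
    StrongDual ℝ (EuclideanSpace ℝ (Fin k)) :=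
  (innerSL ℝ θ).comp (toEuclideanCLM (𝕜 := ℝ) R) + innerSL ℝ (toEuclideanCLM (𝕜 := ℝ) R θ)

lemma quadForm_add (R : Matrix (Fin k) (Fin k) ℝ) (θ ω : EuclideanSpace ℝ (Fin k)) :
    quadForm R (θ + ω) = quadForm R θ + quadFormPolar R θ ω + quadForm R ω := by
  simp only [quadForm_eq_inner, quadFormPolar, map_add, inner_add_left, inner_add_right,
    _root_.add_apply, ContinuousLinearMap.comp_apply, innerSL_apply_apply]
  rw [real_inner_comm ω]
  ring

lemma integrable_quadForm_add (R : Matrix (Fin k) (Fin k) ℝ) (θ : EuclideanSpace ℝ (Fin k)) :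
    Integrable (fun ω ↦ quadForm R (θ + ω)) (multivariateGaussian 0 S) := by
  simp only [quadForm_add]
  exact ((integrable_const _).add
    ((quadFormPolar R θ).integrable_comp IsGaussian.integrable_id)).add (integrable_quadForm R)

/-- The cross term is linear in `ω` and the Gaussian is centered, so smoothing only adds a constant
independent of `θ`. -/
lemma integral_quadForm_add (R : Matrix (Fin k) (Fin k) ℝ) (θ : EuclideanSpace ℝ (Fin k)) :
    ∫ ω, quadForm R (θ + ω) ∂(multivariateGaussian 0 S)
      = quadForm R θ + ∫ ω, quadForm R ω ∂(multivariateGaussian 0 S) := by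
  have h1 : Integrable (fun ω ↦ quadFormPolar R θ ω) (multivariateGaussian 0 S) :=
    (quadFormPolar R θ).integrable_comp IsGaussian.integrable_id
  have h2 : Integrable (fun ω ↦ quadForm R θ + quadFormPolar R θ ω) (multivariateGaussian 0 S) :=
    (integrable_const _).add h1
  simp only [quadForm_add]
  rw [integral_add h2 (integrable_quadForm R), integral_add (integrable_const _) h1,
    IsGaussian.integral_dual, integral_id_multivariateGaussian]
  simp

lemma integrable_objective (hf : ∀ θ θ' : EuclideanSpace ℝ (Fin k), |f θ - f θ'| ≤ L * ‖θ - θ'‖)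
    (R : Matrix (Fin k) (Fin k) ℝ) (θ : EuclideanSpace ℝ (Fin k)) :
    Integrable (fun ω ↦ objective f R (θ + ω)) (multivariateGaussian 0 S) :=
  (integrable_shift hf θ).add ((integrable_quadForm_add R θ).const_mul _)

lemma smooth_objective (hf : ∀ θ θ' : EuclideanSpace ℝ (Fin k), |f θ - f θ'| ≤ L * ‖θ - θ'‖)
    (R : Matrix (Fin k) (Fin k) ℝ) (θ : EuclideanSpace ℝ (Fin k)) :
    smooth (objective f R) S θ = smooth f S θ + 1 / 2 * quadForm R θ
      + 1 / 2 * ∫ ω, quadForm R ω ∂(multivariateGaussian 0 S) := by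
  simp only [smooth, objective]
  rw [integral_add (integrable_shift hf θ) ((integrable_quadForm_add R θ).const_mul _),
    integral_const_mul, integral_quadForm_add]
  ring

/-- Jensen's inequality, in the form `1 + x ≤ exp x` with a mean-zero exponent. -/
lemma sensitivity_nonneg (hf : ∀ θ θ' : EuclideanSpace ℝ (Fin k), |f θ - f θ'| ≤ L * ‖θ - θ'‖)
    {α : ℝ} (hα : 0 < α) (θ : EuclideanSpace ℝ (Fin k)) : 0 ≤ sensitivity f α S θ := by
  have hi : Integrable (fun ω ↦ f (θ + ω)) (multivariateGaussian 0 S) := integrable_shift hf θ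
  have hc : Integrable (fun ω ↦ α * (f (θ + ω) - smooth f S θ)) (multivariateGaussian 0 S) :=
    (hi.sub (integrable_const _)).const_mul α
  have he : Integrable (fun ω ↦ Real.exp (α * (f (θ + ω) - smooth f S θ)))
      (multivariateGaussian 0 S) := by
    simp only [mul_sub, Real.exp_sub]
    exact (integrable_exp_shift hf α θ).div_const _
  refine mul_nonneg (by positivity) (Real.log_nonneg ?_)
  calc (1 : ℝ) = ∫ ω, (α * (f (θ + ω) - smooth f S θ) + 1) ∂(multivariateGaussian 0 S) := by
        rw [integral_add hc (integrable_const _), integral_const_mul,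
          integral_sub hi (integrable_const _)]
        simp [smooth]
    _ ≤ _ := integral_mono (hc.add (integrable_const _)) he fun ω ↦ Real.add_one_le_exp _

lemma softSmooth_eq (hf : ∀ θ θ' : EuclideanSpace ℝ (Fin k), |f θ - f θ'| ≤ L * ‖θ - θ'‖)
    {α : ℝ} (hα : 0 < α) (θ : EuclideanSpace ℝ (Fin k)) :
    softSmooth f α S θ = smooth f S θ + sensitivity f α S θ := by
  have hpos := integral_exp_pos (integrable_exp_shift (S := S) hf α θ)
  simp only [softSmooth, sensitivity, mul_sub, Real.exp_sub]
  rw [integral_div, Real.log_div hpos.ne' (Real.exp_ne_zero _), Real.log_exp]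
  field_simp
  ring

/-- Concentration for `α * f (θ + ·)`, with Lipschitz constant `α * |L|`; taking logarithms and
dividing by `α` leaves one factor `α`. -/
lemma sensitivity_le (hf : ∀ θ θ' : EuclideanSpace ℝ (Fin k), |f θ - f θ'| ≤ L * ‖θ - θ'‖)
    {α : ℝ} (hα : 0 < α) (hS : S.PosSemidef) (θ : EuclideanSpace ℝ (Fin k)) :
    sensitivity f α S θ ≤ 1 / 2 * α * L ^ 2 * lambdaMax hS.isHermitian := by
  have hpos := integral_exp_pos (integrable_exp_shift (S := S) hf α θ)
  have h := integral_exp_le_of_lipschitz (μ := multivariateGaussian 0 S)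
    (f := fun ω ↦ α * f (θ + ω)) (L := α * |L|) integral_id_multivariateGaussian'
    (integral_dual_sq_le hS) (lambdaMax_nonneg hS) (by positivity) fun x y ↦ by
      rw [← mul_sub, abs_mul, abs_of_pos hα, mul_assoc]
      gcongr
      simpa using abs_sub_le_abs_mul hf (θ + x) (θ + y)
  rw [← Real.log_le_iff_le_exp hpos, integral_const_mul, mul_pow, sq_abs] at h
  have hs := softSmooth_eq (S := S) hf hα θ
  rw [← sub_eq_iff_eq_add'] at hs
  rw [← hs, softSmooth, sub_le_iff_le_add, one_div, inv_mul_le_iff₀ hα]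
  refine h.trans_eq ?_
  simp only [smooth]
  ring

end Smoothing

end GaussianConvexification

theorem theorem3 {k : ℕ}
    (f : EuclideanSpace ℝ (Fin k) → ℝ) (L : ℝ)
    (hf : ∀ θ θ' : EuclideanSpace ℝ (Fin k), |f θ - f θ'| ≤ L * ‖θ - θ'‖)
    (α : ℝ) (hα : 0 < α)
    (S : Matrix (Fin k) (Fin k) ℝ) (hS : S.PosSemidef)
    (R : Matrix (Fin k) (Fin k) ℝ) (hR : R.PosSemidef)
    (C : Set (EuclideanSpace ℝ (Fin k))) (hC : Convex ℝ C) :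
    -- all expectations involved are finite
    (∀ θ : EuclideanSpace ℝ (Fin k),
      Integrable (fun ω => f (θ + ω)) (multivariateGaussian 0 S) ∧
      Integrable (fun ω => Real.exp (α * f (θ + ω))) (multivariateGaussian 0 S) ∧
      Integrable (fun ω => GaussianConvexification.objective f R (θ + ω))
        (multivariateGaussian 0 S)) ∧
    -- the bound on the sensitivity function
    (∀ θ : EuclideanSpace ℝ (Fin k),
      GaussianConvexification.sensitivity f α S θ
        ≤ 1 / 2 * α * L ^ 2 * GaussianConvexification.lambdaMax hS.isHermitian) ∧
    -- the suboptimality bound for every minimizer of the convexified problem over `C`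
    (∀ θα ∈ C, IsMinOn (GaussianConvexification.convexified f α S R) C θα →
      BddBelow (GaussianConvexification.smooth (GaussianConvexification.objective f R) S '' C) ∧
      GaussianConvexification.smooth (GaussianConvexification.objective f R) S θα
        - sInf (GaussianConvexification.smooth (GaussianConvexification.objective f R) S '' C)
        ≤ α * L ^ 2 * GaussianConvexification.lambdaMax hS.isHermitian / 2) := by
  open GaussianConvexification in
  refine ⟨fun θ ↦ ⟨integrable_shift hf θ, integrable_exp_shift hf α θ,
    integrable_objective hf R θ⟩, sensitivity_le hf hα hS, fun θα hθα hmin ↦ ?_⟩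
  open GaussianConvexification in
  -- Minimality compares smoothed `g` plus sensitivity at `θα` and `θ`, the constant from
  -- `smooth_objective` cancelling. Drop the nonnegative sensitivity at `θα` and bound the one at
  -- `θ`; the result gives both boundedness below and the gap.
  have key : ∀ y ∈ smooth (objective f R) S '' C, smooth (objective f R) S θα
      - α * L ^ 2 * lambdaMax hS.isHermitian / 2 ≤ y := by
    rintro _ ⟨θ, hθ, rfl⟩
    have hle : convexified f α S R θα ≤ convexified f α S R θ := hmin hθ
    simp only [convexified, softSmooth_eq hf hα] at hle
    rw [smooth_objective hf, smooth_objective hf]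
    linarith [sensitivity_nonneg (S := S) hf hα θα, sensitivity_le hf hα hS θ]
  refine ⟨⟨_, key⟩, ?_⟩
  have := le_csInf (Set.Nonempty.image _ ⟨θα, hθα⟩) key
  linarith
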